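/- Let $k$ be a field and let $\mathcal{A}$ be an essentially small additive category which is $k$-trivial: for all objects $x,y$ of $\mathcal{A}$ the abelian group $\mathcal{A}(x,y)$ is finite, of order invertible in $k$. Let $\mathcal{F}(\mathcal{A};k)$ be the category of all (not necessarily additive) functors from $\mathcal{A}$ to $k$-vector spaces, with the pointwise tensor product over $k$, $(F\otimes G)(a)=F(a)\otimes_k G(a)$. For an object $x$ of $\mathcal{A}$ and $F$ in $\mathcal{F}(\mathcal{A};k)$, let $\tau_x(F)=F(x\oplus -)$, and let $\bar\tau_x(F)$ be the quotient functor of $\tau_x(F)$ given by the coinvariants $$\bar\tau_x(F)(a)=F(x\oplus a)_{\mathcal{A}(x,a)},$$ where $u\in\mathcal{A}(x,a)$ acts through the automorphism $\begin{pmatrix}\mathrm{Id}_x&0\\u&\mathrm{Id}_a\end{pmatrix}$ of $x\oplus a$. Let $\bar\delta_x(F)$ be the cokernel of the natural morphism $F\to\bar\tau_x(F)$ induced by the inclusions $a\to x\oplus a$. For $d\in\mathbb{N}$, let $\mathcal{F}_d(\mathcal{A};k)$ be the full subcategory of $\mathcal{F}(\mathcal{A};k)$ of those functors $F$ such that $$\bar\delta_{a_0}\cdots\bar\delta_{a_d}\,\tau_x(F)=0\quad\text{for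 all objects } a_0,\dots,a_d,x \text{ of } \mathcal{A}.$$ Let $n,m\in\mathbb{N}$, let $F$ belong to $\mathcal{F}_n(\mathcal{A};k)$ and $G$ to $\mathcal{F}_m(\mathcal{A};k)$. Then $F\otimes G$ belongs to $\mathcal{F}_{n+m}(\mathcal{A};k)$. -/

import Mathlib

open CategoryTheory CategoryTheory.Limits
open scoped MonoidalCategory

universe w v u

namespace ParabolicFunctors

variable (k : Type w) [Field k]
variable (C : Type u) [Category.{v} C] [Preadditive C]

/-- A preadditive category is `k`-trivial if all its morphism groups are finite, of order
invertible in the field `k`. -/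
structure IsKTrivial : Prop where
  finite_hom : ∀ x y : C, Finite (x ⟶ y)
  isUnit_card : ∀ x y : C, IsUnit (Nat.card (x ⟶ y) : k)

variable {k C} [HasBinaryBiproducts C]

/-- The endofunctor `x ⊕ -` of an additive category. -/
@[simps]
noncomputable def addLeft (x : C) : C ⥤ C where
  obj a := x ⊞ a
  map f := biprod.map (𝟙 x) f

variable (k) in
/-- The shift functor `τ_x`: precomposition with `x ⊕ -`. -/
noncomputable def tau (x : C) : (C ⥤ ModuleCat.{w} k) ⥤ (C ⥤ ModuleCat.{w} k) :=
  (Functor.whiskeringLeft C C (ModuleCat.{w} k)).obj (addLeft x)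

/-- The action of the abelian group `Hom(x, a)` on `F (x ⊕ a)`, in which `u : x ⟶ a` acts by
the automorphism of `x ⊕ a` with components `id : x ⟶ x`, `u : x ⟶ a`, `0 : a ⟶ x`,
`id : a ⟶ a`. -/
noncomputable def shearRep (F : C ⥤ ModuleCat.{w} k) (x a : C) :
    Representation k (Multiplicative (x ⟶ a)) (F.obj (x ⊞ a)) where
  toFun u := (F.map (Biprod.unipotentUpper u.toAdd).hom).hom
  map_one' := by
    have h : (Biprod.unipotentUpper (0 : x ⟶ a)).hom = 𝟙 (x ⊞ a) := by
      ext <;> simp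
    simp only [toAdd_one, h, F.map_id]
    rfl
  map_mul' u u' := by
    have h : (Biprod.unipotentUpper (u.toAdd + u'.toAdd)).hom =
        (Biprod.unipotentUpper u'.toAdd).hom ≫ (Biprod.unipotentUpper u.toAdd).hom := by
      simp
    simp only [toAdd_mul, h, F.map_comp]
    rfl

lemma unipotentUpper_map {x a b : C} (f : a ⟶ b) (u : x ⟶ a) :
    (Biprod.unipotentUpper u).hom ≫ biprod.map (𝟙 x) f =
      biprod.map (𝟙 x) f ≫ (Biprod.unipotentUpper (u ≫ f)).hom := by
  ext <;> simp [Biprod.ofComponents]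

lemma shearRep_map (F : C ⥤ ModuleCat.{w} k) (x : C) {a b : C} (f : a ⟶ b) (u : x ⟶ a) :
    (F.map (biprod.map (𝟙 x) f)).hom ∘ₗ shearRep F x a (Multiplicative.ofAdd u) =
      shearRep F x b (Multiplicative.ofAdd (u ≫ f)) ∘ₗ (F.map (biprod.map (𝟙 x) f)).hom := by
  have h := congrArg (fun g => (F.map g).hom) (unipotentUpper_map f u)
  simp only [F.map_comp, ModuleCat.hom_comp] at h
  exact h

lemma shearRep_app {F G : C ⥤ ModuleCat.{w} k} (α : F ⟶ G) (x a : C)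
    (u : Multiplicative (x ⟶ a)) :
    (α.app (x ⊞ a)).hom ∘ₗ shearRep F x a u = shearRep G x a u ∘ₗ (α.app (x ⊞ a)).hom := by
  have h := congrArg ModuleCat.Hom.hom (α.naturality (Biprod.unipotentUpper u.toAdd).hom)
  simp only [ModuleCat.hom_comp] at h
  exact h

/-- The functor `a ↦ F (x ⊕ a)_{Hom(x, a)}` (coinvariants). -/
noncomputable def tauBarObj (x : C) (F : C ⥤ ModuleCat.{w} k) : C ⥤ ModuleCat.{w} k where
  obj a := ModuleCat.of k (shearRep F x a).Coinvariants
  map {a b} f := ModuleCat.ofHom <| Representation.Coinvariants.lift _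
    (Representation.Coinvariants.mk (shearRep F x b) ∘ₗ (F.map (biprod.map (𝟙 x) f)).hom)
    (fun u => by
      rw [LinearMap.comp_assoc]
      erw [shearRep_map F x f u.toAdd]
      ext y
      simp)
  map_id a := by
    have h : biprod.map (𝟙 x) (𝟙 a) = 𝟙 (x ⊞ a) := by
      ext <;> simp
    apply ModuleCat.hom_ext
    apply Representation.Coinvariants.hom_ext
    ext y
    simp [h]
  map_comp {a b c} f g := by
    have h : biprod.map (𝟙 x) (f ≫ g) = biprod.map (𝟙 x) f ≫ biprod.map (𝟙 x) g := by
      ext <;> simp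
    apply ModuleCat.hom_ext
    apply Representation.Coinvariants.hom_ext
    ext y
    simp [h]

variable (k) in
/-- The parabolic shift functor `τ̄_x`. -/
noncomputable def tauBar (x : C) : (C ⥤ ModuleCat.{w} k) ⥤ (C ⥤ ModuleCat.{w} k) where
  obj F := tauBarObj x F
  map {F G} α :=
    { app := fun a => ModuleCat.ofHom <| Representation.Coinvariants.map _ _
        { toLinearMap := (α.app (x ⊞ a)).hom
          isIntertwining' := shearRep_app α x a }
      naturality := fun a b f => by
        apply ModuleCat.hom_ext
        apply Representation.Coinvariants.hom_ext
        ext y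
        have h := congrArg (fun g => g.hom y) (α.naturality (biprod.map (𝟙 x) f))
        simp only [ModuleCat.hom_comp, LinearMap.comp_apply] at h
        exact congrArg (Representation.Coinvariants.mk (shearRep G x b)) h }
  map_id F := by
    ext a : 2
    apply ModuleCat.hom_ext
    apply Representation.Coinvariants.hom_ext
    ext y
    rfl
  map_comp α β := by
    ext a : 2
    apply ModuleCat.hom_ext
    apply Representation.Coinvariants.hom_ext
    ext y
    rfl

variable (k) in
/-- The canonical projection `τ_x ⟶ τ̄_x`. -/
noncomputable def tauToTauBar (x : C) : tau k x ⟶ tauBar k x where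
  app F :=
    { app := fun a => ModuleCat.ofHom (Representation.Coinvariants.mk (shearRep F x a))
      naturality := fun _ _ _ => rfl }
  naturality _ _ _ := rfl

variable (k) in
/-- The natural transformation `Id ⟶ τ_x` given by the inclusions `a ⟶ x ⊕ a`. -/
noncomputable def idToTau (x : C) : 𝟭 (C ⥤ ModuleCat.{w} k) ⟶ tau k x where
  app F :=
    { app := fun a => F.map biprod.inr
      naturality := fun a b f => by
        change F.map f ≫ F.map biprod.inr = F.map biprod.inr ≫ F.map (biprod.map (𝟙 x) f)
        rw [← F.map_comp, ← F.map_comp, biprod.inr_map] }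
  naturality F G α := by
    ext a : 2
    exact (α.naturality biprod.inr).symm

variable (k) in
/-- The natural transformation `Id ⟶ τ̄_x`. -/
noncomputable def idToTauBar (x : C) : 𝟭 (C ⥤ ModuleCat.{w} k) ⟶ tauBar k x :=
  idToTau k x ≫ tauToTauBar k x

variable (k) in
/-- The parabolic difference functor `δ̄_x`: the cokernel of `Id ⟶ τ̄_x`. -/
noncomputable def deltaBar (x : C) : (C ⥤ ModuleCat.{w} k) ⥤ (C ⥤ ModuleCat.{w} k) where
  obj F := cokernel ((idToTauBar k x).app F)
  map {F G} α := cokernel.map _ _ α ((tauBar k x).map α) ((idToTauBar k x).naturality α).symm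
  map_id F := by
    rw [← cancel_epi (cokernel.π _)]
    simp
  map_comp α β := by
    rw [← cancel_epi (cokernel.π _)]
    simp

variable (k) in
/-- The composite `δ̄_{a₀} ⋯ δ̄_{a_r}` associated with the list `[a₀, …, a_r]`
(`δ̄_{a_r}` is applied first). -/
noncomputable def deltaBarIter :
    List C → ((C ⥤ ModuleCat.{w} k) ⥤ (C ⥤ ModuleCat.{w} k))
  | [] => 𝟭 _
  | a :: l => deltaBarIter l ⋙ deltaBar k a

variable (k C) in
/-- The full subcategory `𝓕_d(C; k)` of the category of functors from `C` to `k`-vector spaces: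
those `F` such that `δ̄_{a₀} ⋯ δ̄_{a_d} τ_x F = 0` for all objects `a₀, …, a_d, x` of `C`. -/
def IsInF (d : ℕ) : ObjectProperty (C ⥤ ModuleCat.{w} k) := fun F =>
  ∀ (a : Fin (d + 1) → C) (x : C), IsZero ((deltaBarIter k (List.ofFn a)).obj ((tau k x).obj F))

end ParabolicFunctors

/-!
After extending scalars to an algebraically closed field `K`, the functions `v ↦ ℓ (F(v) z)` on the
finite groups `Hom(y, P)` can be recovered from their Fourier transforms, since the orders of these
groups are invertible in `K`. Each character `χ` of `Hom(y, P)` is a section of the presheaf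
`a ↦ Hom(y, a)^∨`, and `F` lies in `𝓕_d` if and only if the Fourier transforms vanish at every `χ`
whose generated subpresheaf has a chain of length `d + 1` of subpresheaves generated by
restrictions of `χ`. Passing from `F` to `δ̄_a F` shortens such chains by one step: shears identify
the Fourier coefficients at the characters of `Hom(Y, a ⊕ P)` whose first component is induced from
the second, and the quotient by the image of `F` makes their sum zero.

The Fourier transform of a matrix coefficient of `F ⊗ G` at `χ` is a sum over the decompositions
`χ = χ₁ + χ₂`. A chain of length `n + m + 1` for `χ` splits into chains of lengths `p` and `q` for
`χ₁` and `χ₂`, with `p + q = n + m + 1`, so that `p > n` or `q > m`.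
-/

namespace ParabolicFunctors

section Fourier

variable {A B K : Type*} [AddCommGroup A] [AddCommGroup B] [Field K]

instance finite_addChar [Finite A] : Finite (AddChar A K) :=
  have := (linearIndependent_monoidHom (Multiplicative A) K).finite
  .of_equiv _ AddChar.toMonoidHomEquiv.symm

noncomputable instance fintypeAddChar [Finite A] : Fintype (AddChar A K) := Fintype.ofFinite _

/-- The value at the character `-χ` of the unnormalised Fourier transform of `f`. -/
def fourierSum [Fintype A] (χ : AddChar A K) (f : A → K) : K := ∑ v, χ v * f v

lemma fourierSum_add_right [Fintype A] (χ : AddChar A K) (f : A → K) (c : A) :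
    fourierSum χ (fun v => f (v + c)) = χ (-c) * fourierSum χ f := by
  rw [fourierSum, fourierSum, Finset.mul_sum]
  refine Fintype.sum_equiv (Equiv.addRight c) _ _ fun v => ?_
  rw [Equiv.coe_addRight, ← mul_assoc, ← AddChar.map_add_eq_mul, neg_add_cancel_comm_assoc]

lemma card_addSubgroup_ne_zero [Fintype A] (hA : (Fintype.card A : K) ≠ 0) (H : AddSubgroup A)
    [Fintype H] : (Fintype.card H : K) ≠ 0 := by
  obtain ⟨m, hm⟩ := H.card_addSubgroup_dvd_card
  rw [← Nat.card_eq_fintype_card, hm, Nat.cast_mul, Nat.card_eq_fintype_card] at hA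
  exact left_ne_zero_of_mul hA

variable [Fintype A] [IsAlgClosed K]

lemma exists_addChar_ne_one (hA : (Fintype.card A : K) ≠ 0) {a : A} (ha : a ≠ 0) :
    ∃ χ : AddChar A K, χ a ≠ 1 := by
  have : NeZero (Monoid.exponent (Multiplicative A) : K) := by
    obtain ⟨m, hm⟩ := Group.exponent_dvd_card (G := Multiplicative A)
    rw [Fintype.card_multiplicative] at hm
    rw [hm, Nat.cast_mul] at hA
    exact ⟨left_ne_zero_of_mul hA⟩
  obtain ⟨φ, hφ⟩ := CommGroup.exists_apply_ne_one_of_hasEnoughRootsOfUnity (Multiplicative A) K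
    (a := Multiplicative.ofAdd a) (by simpa using ha)
  exact ⟨AddChar.toMonoidHomEquiv.symm ((Units.coeHom K).comp φ), fun h => hφ (Units.ext h)⟩

lemma sum_addChar_apply_of_ne_zero (hA : (Fintype.card A : K) ≠ 0) {a : A} (ha : a ≠ 0) :
    ∑ χ : AddChar A K, χ a = 0 := by
  classical
  have hne : (AddChar.doubleDualEmb a : AddChar (AddChar A K) K) ≠ 0 :=
    AddChar.ne_zero_iff.2 (exists_addChar_ne_one hA ha)
  exact (AddChar.sum_eq_ite _).trans (if_neg hne)

lemma cast_card_addChar (hA : (Fintype.card A : K) ≠ 0) :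
    (Fintype.card (AddChar A K) : K) = Fintype.card A := by
  classical
  calc (Fintype.card (AddChar A K) : K)
      = ∑ a : A, ∑ χ : AddChar A K, χ a := by
        rw [Finset.sum_eq_single 0 (fun a _ ha => sum_addChar_apply_of_ne_zero hA ha) (by simp)]
        simp
    _ = ∑ χ : AddChar A K, ∑ a : A, χ a := Finset.sum_comm
    _ = Fintype.card A := by simp [AddChar.sum_eq_ite]

lemma card_mul_eq_sum_fourierSum (hA : (Fintype.card A : K) ≠ 0) (f : A → K) (a : A) :
    Fintype.card A * f a = ∑ χ : AddChar A K, χ (-a) * fourierSum χ f := by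
  have hsum (v : A) : ∑ χ : AddChar A K, χ (-a) * (χ v * f v) =
      (∑ χ : AddChar A K, χ (v - a)) * f v := by
    simp only [← mul_assoc, Finset.sum_mul, ← AddChar.map_add_eq_mul, neg_add_eq_sub]
  simp only [fourierSum, Finset.mul_sum]
  rw [Finset.sum_comm, Finset.sum_eq_single a]
  · rw [hsum, ← cast_card_addChar hA]
    simp
  · intro v _ hv
    rw [hsum, sum_addChar_apply_of_ne_zero hA (sub_ne_zero.2 hv), zero_mul]
  · simp

lemma eq_zero_of_fourierSum_eq_zero (hA : (Fintype.card A : K) ≠ 0) {f : A → K}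
    (hf : ∀ χ : AddChar A K, fourierSum χ f = 0) : f = 0 := by
  ext a
  refine (mul_eq_zero.1 ?_).resolve_left hA
  simp [card_mul_eq_sum_fourierSum hA, hf]

/-- The Fourier transform of the pullback of `f` along `φ` is obtained by summing that of `f`
over the fibres of the restriction of characters along `φ`. -/
lemma fourierSum_comp_add_eq_zero [Fintype B] (hA : (Fintype.card A : K) ≠ 0) (φ : B →+ A) (c : A)
    {f : A → K} {χ : AddChar B K}
    (hf : ∀ ψ : AddChar A K, ψ.compAddMonoidHom φ = χ → fourierSum ψ f = 0) :
    fourierSum χ (fun v => f (φ v + c)) = 0 := by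
  classical
  refine (mul_eq_zero.1 ?_).resolve_left hA
  calc Fintype.card A * fourierSum χ (fun v => f (φ v + c))
      = ∑ v, χ v * (Fintype.card A * f (φ v + c)) := by
        rw [fourierSum, Finset.mul_sum]
        exact Finset.sum_congr rfl fun v _ => mul_left_comm _ _ _
    _ = ∑ v, ∑ ψ : AddChar A K,
          ψ (-c) * fourierSum ψ f * (χ - ψ.compAddMonoidHom φ) v := by
        simp only [card_mul_eq_sum_fourierSum hA, Finset.mul_sum, neg_add,
          AddChar.map_add_eq_mul, AddChar.sub_apply, AddChar.compAddMonoidHom_apply, map_neg]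
        exact Finset.sum_congr rfl fun v _ => Finset.sum_congr rfl fun ψ _ => by ring
    _ = ∑ ψ : AddChar A K, ψ (-c) * fourierSum ψ f * ∑ v, (χ - ψ.compAddMonoidHom φ) v := by
        rw [Finset.sum_comm]
        simp only [Finset.mul_sum]
    _ = 0 := Finset.sum_eq_zero fun ψ _ => ?_
  by_cases hψ : ψ.compAddMonoidHom φ = χ
  · rw [hf ψ hψ, mul_zero, zero_mul]
  · rw [AddChar.sum_eq_ite, if_neg (sub_ne_zero.2 (Ne.symm hψ)), mul_zero]

/-- Writing `χ = χ₁ + χ₂` in all possible ways is restricting characters of `A × A` to the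
diagonal. -/
lemma fourierSum_diag_eq_zero (hA : (Fintype.card A : K) ≠ 0) {h : A → A → K} {χ : AddChar A K}
    (hh : ∀ χ₁ χ₂ : AddChar A K, χ₁ + χ₂ = χ →
      (∀ v', fourierSum χ₁ (h · v') = 0) ∨ ∀ v, fourierSum χ₂ (h v) = 0) :
    fourierSum χ (fun v => h v v) = 0 := by
  have hAA : (Fintype.card (A × A) : K) ≠ 0 := by simpa using hA
  have hdiag := fourierSum_comp_add_eq_zero hAA ((AddMonoidHom.id A).prod (AddMonoidHom.id A)) 0
    (f := Function.uncurry h) (χ := χ) fun ψ hψ => ?_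
  · simpa using hdiag
  let χ₁ := ψ.compAddMonoidHom (AddMonoidHom.inl A A)
  let χ₂ := ψ.compAddMonoidHom (AddMonoidHom.inr A A)
  have hψ_apply (v v' : A) : ψ (v, v') = χ₁ v * χ₂ v' := by
    simp [χ₁, χ₂, ← AddChar.map_add_eq_mul]
  have hχ : χ₁ + χ₂ = χ := by
    ext v
    simp [← hψ, ← hψ_apply]
  simp only [fourierSum, Fintype.sum_prod_type, hψ_apply, Function.uncurry_apply_pair]
  obtain h₁ | h₂ := hh χ₁ χ₂ hχ
  · rw [Finset.sum_comm]
    refine Finset.sum_eq_zero fun v' _ => ?_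
    rw [← mul_zero (χ₂ v'), ← h₁ v', fourierSum, Finset.mul_sum]
    exact Finset.sum_congr rfl fun v _ => by ring
  · refine Finset.sum_eq_zero fun v _ => ?_
    rw [← mul_zero (χ₁ v), ← h₂ v, fourierSum, Finset.mul_sum]
    exact Finset.sum_congr rfl fun v' _ => by ring

lemma sum_fourierSum_add_comp_eq_zero [Fintype B] (hA : (Fintype.card A : K) ≠ 0) (p : B →+ A)
    {f : B → K} (hf : ∀ w, p w = 0 → f w = 0) (ψ : AddChar B K) :
    ∑ θ : AddChar A K, fourierSum (ψ + θ.compAddMonoidHom p) f = 0 := by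
  simp only [fourierSum]
  rw [Finset.sum_comm]
  refine Finset.sum_eq_zero fun w _ => ?_
  have hsum : ∑ θ : AddChar A K, (ψ + θ.compAddMonoidHom p) w * f w =
      (∑ θ : AddChar A K, θ (p w)) * (ψ w * f w) := by
    rw [Finset.sum_mul]
    exact Finset.sum_congr rfl fun θ _ => by
      rw [AddChar.add_apply, AddChar.compAddMonoidHom_apply]
      ring
  by_cases hw : p w = 0
  · simp only [hf w hw, mul_zero, Finset.sum_const_zero]
  · rw [hsum, sum_addChar_apply_of_ne_zero hA hw, zero_mul]

lemma card_addSubgroup_addChar_ne_zero (hA : (Fintype.card A : K) ≠ 0)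
    (H : AddSubgroup (AddChar A K)) [Fintype H] : (Fintype.card H : K) ≠ 0 :=
  card_addSubgroup_ne_zero (by rwa [cast_card_addChar hA]) H

lemma fourierSum_add_comp_eq_zero_of_addSubgroup [Fintype B] (hA : (Fintype.card A : K) ≠ 0)
    (p : B →+ A) {f : B → K} (hf : ∀ w, p w = 0 → f w = 0) (ψ : AddChar B K)
    (H : AddSubgroup (AddChar A K))
    (hmem : ∀ θ ∈ H, fourierSum (ψ + θ.compAddMonoidHom p) f = fourierSum ψ f)
    (hnotMem : ∀ θ ∉ H, fourierSum (ψ + θ.compAddMonoidHom p) f = 0) (θ : AddChar A K) :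
    fourierSum (ψ + θ.compAddMonoidHom p) f = 0 := by
  classical
  have hite (θ : AddChar A K) : fourierSum (ψ + θ.compAddMonoidHom p) f =
      if θ ∈ H then fourierSum ψ f else 0 := by
    split_ifs with hθ
    exacts [hmem θ hθ, hnotMem θ hθ]
  have hsum := sum_fourierSum_add_comp_eq_zero hA p hf ψ
  simp only [hite] at hsum
  rw [← Finset.sum_filter, Finset.sum_const, nsmul_eq_mul, ← Fintype.card_subtype] at hsum
  have hψ := (mul_eq_zero.1 hsum).resolve_left (card_addSubgroup_addChar_ne_zero hA H)
  rw [hite, hψ, ite_self]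

lemma exists_apply_ne_one_of_notMem (hA : (Fintype.card A : K) ≠ 0)
    {H : AddSubgroup (AddChar A K)} {θ : AddChar A K} (hθ : θ ∉ H) :
    ∃ t, (∀ ψ ∈ H, ψ t = 1) ∧ θ t ≠ 1 := by
  classical
  by_contra! hann
  let ev : A →+ AddChar H K := AddMonoidHom.mk'
    (fun t => (AddChar.doubleDualEmb t).compAddMonoidHom H.subtype)
    fun s t => by ext ψ; simp
  have hsum_ker (t : A) : ∑ ψ : H, (ψ - θ : AddChar A K) t =
      if t ∈ ev.ker then (Fintype.card H : K) else 0 := by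
    have hsum : ∑ ψ : H, (ψ : AddChar A K) t = if ev t = 0 then (Fintype.card H : K) else 0 :=
      AddChar.sum_eq_ite (ev t)
    simp only [AddChar.sub_apply, ← Finset.sum_mul, hsum, AddMonoidHom.mem_ker]
    split_ifs with ht
    · have hθt : θ t = 1 := hann t fun ψ hψ => DFunLike.congr_fun ht ⟨ψ, hψ⟩
      rw [AddChar.map_neg_eq_inv, hθt, inv_one, mul_one]
    · rw [zero_mul]
  have hsum_H (ψ : H) : ∑ t, (ψ - θ : AddChar A K) t = 0 := by
    rw [AddChar.sum_eq_ite, if_neg]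
    exact fun h => hθ (sub_eq_zero.1 h ▸ ψ.2)
  have hcard : (Fintype.card ev.ker : K) * Fintype.card H = 0 := by
    calc (Fintype.card ev.ker : K) * Fintype.card H
        = ∑ t, ∑ ψ : H, (ψ - θ : AddChar A K) t := by
          simp only [hsum_ker, ← Finset.sum_filter, Finset.sum_const, nsmul_eq_mul,
            Fintype.card_subtype]
      _ = 0 := by rw [Finset.sum_comm, Finset.sum_eq_zero fun ψ _ => hsum_H ψ]
  exact mul_ne_zero (card_addSubgroup_ne_zero hA ev.ker)
    (card_addSubgroup_addChar_ne_zero hA H) hcard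

end Fourier

section Depth

open Opposite

universe t

variable {C : Type u} [Category.{v} C]

/-- `HasDepth M r x` holds if the subpresheaf of `M` generated by the section `x` contains a
strictly increasing chain of `r + 1` subpresheaves, each generated by a restriction of `x`. -/
def HasDepth (M : Cᵒᵖ ⥤ AddCommGrpCat.{t}) : ℕ → ∀ {P : C}, M.obj (op P) → Prop
  | 0, _, _ => True
  | r + 1, P, x => ∃ (a b : C) (i : b ⟶ P) (j : a ⟶ P), HasDepth M r (M.map i.op x) ∧
      ∀ u : a ⟶ b, M.map j.op x ≠ M.map u.op (M.map i.op x)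

variable {M N : Cᵒᵖ ⥤ AddCommGrpCat.{t}}

lemma map_op_map_op {P Q R : C} (i : Q ⟶ P) (u : R ⟶ Q) (x : M.obj (op P)) :
    M.map u.op (M.map i.op x) = M.map (u ≫ i).op x := by
  simp

lemma HasDepth.of_map {b P : C} (i : b ⟶ P) {r : ℕ} {x : M.obj (op P)}
    (h : HasDepth M r (M.map i.op x)) : HasDepth M r x := by
  cases r with
  | zero => trivial
  | succ r =>
    obtain ⟨a', b', i', j', hi, hj⟩ := h
    refine ⟨a', b', i' ≫ i, j' ≫ i, ?_, fun u => ?_⟩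
    · rwa [← map_op_map_op]
    · rw [← map_op_map_op, ← map_op_map_op]
      exact hj u

lemma HasDepth.mono {r s : ℕ} (hrs : r ≤ s) {P : C} {x : M.obj (op P)} (h : HasDepth M s x) :
    HasDepth M r x := by
  induction hrs with
  | refl => exact h
  | step _ ih =>
    obtain ⟨_, _, i, _, hi, _⟩ := h
    exact ih (hi.of_map i)

lemma HasDepth.of_app (α : M ⟶ N) {r : ℕ} {P : C} {x : M.obj (op P)}
    (h : HasDepth N r (α.app (op P) x)) : HasDepth M r x := by
  induction r generalizing P with
  | zero => trivial
  | succ r ih =>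
    obtain ⟨a, b, i, j, hi, hj⟩ := h
    have hα {Q : C} (f : Q ⟶ P) : N.map f.op (α.app (op P) x) = α.app (op Q) (M.map f.op x) :=
      (NatTrans.naturality_apply α f.op x).symm
    refine ⟨a, b, i, j, ih (by rwa [← hα]), fun u hu => hj u ?_⟩
    rw [map_op_map_op, hα, hu, hα, map_op_map_op]

variable [Preadditive C] [M.Additive]

lemma map_op_sub {P Q : C} (i j : Q ⟶ P) (x : M.obj (op P)) :
    M.map (i - j).op x = M.map i.op x - M.map j.op x := by
  rw [op_sub, M.map_sub]
  rfl

lemma map_op_add {P Q : C} (i j : Q ⟶ P) (x : M.obj (op P)) :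
    M.map (i + j).op x = M.map i.op x + M.map j.op x := by
  rw [op_add, M.map_add]
  rfl

/-- When a step `(i, j)` of the chain of `x + y` is not one of the chain of `x`, correcting `j` by
`i` kills `x`, and the corrected pair is a step of the chain of `y`. -/
lemma exists_hasDepth_of_hasDepth_add [HasBinaryBiproducts C] {P : C} {r : ℕ} {x y : M.obj (op P)}
    (h : HasDepth M r (x + y)) :
    ∃ p q, p + q = r ∧ HasDepth M p x ∧
      ∃ (c : C) (e : c ⟶ P), M.map e.op x = 0 ∧ HasDepth M q (M.map e.op y) := by
  induction r generalizing P with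
  | zero => exact ⟨0, 0, rfl, trivial, P, 0, by simp, trivial⟩
  | succ r ih =>
    obtain ⟨a, b, i, j, hi, hj⟩ := h
    rw [map_add] at hi
    obtain ⟨p, q, hpq, hp, c, e, he, hq⟩ := ih hi
    by_cases hu : ∃ u : a ⟶ b, M.map j.op x = M.map u.op (M.map i.op x)
    · obtain ⟨u, hu⟩ := hu
      rw [map_op_map_op] at hu he
      have hjx : M.map (j - u ≫ i).op x = 0 := by rw [map_op_sub, hu, sub_self]
      refine ⟨p, q + 1, by omega, hp.of_map i, c ⊞ a, biprod.desc (e ≫ i) (j - u ≫ i), ?_,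
        a, c, biprod.inl, biprod.inr, ?_, fun w hw => hj (u + w ≫ e) ?_⟩
      · rw [biprod.desc_eq, map_op_add, ← map_op_map_op, ← map_op_map_op (j - u ≫ i), he, hjx]
        simp
      · rwa [map_op_map_op, biprod.inl_desc, ← map_op_map_op]
      · simp only [map_op_map_op, biprod.inl_desc, biprod.inr_desc, map_op_sub] at hw
        have hex : M.map (w ≫ e ≫ i).op x = 0 := by rw [← map_op_map_op, he, map_zero]
        rw [map_op_map_op, Preadditive.add_comp, Category.assoc]
        simp only [map_op_add, map_add, hu, hex, ← hw]
        abel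
    · exact ⟨p + 1, q, by omega, ⟨a, b, i, j, hp, fun u h => hu ⟨u, h⟩⟩, c, e ≫ i,
        by rw [← map_op_map_op, he], by rwa [← map_op_map_op]⟩

section CharPresheaf

variable {K : Type*} [Field K]

/-- Pullback of characters along a homomorphism of abelian groups, as a homomorphism. -/
def charPullback {A B : Type*} [AddCommGroup A] [AddCommGroup B] (φ : A →+ B) :
    AddChar B K →+ AddChar A K where
  toFun χ := χ.compAddMonoidHom φ
  map_zero' := rfl
  map_add' _ _ := rfl

lemma charPullback_add {A B : Type*} [AddCommGroup A] [AddCommGroup B] (φ ψ : A →+ B) :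
    charPullback (φ + ψ) = charPullback φ + (charPullback ψ : AddChar B K →+ AddChar A K) :=
  AddMonoidHom.ext fun χ => AddChar.ext _ _ fun v => χ.map_add_eq_mul (φ v) (ψ v)

variable (K) in
/-- The presheaf `a ↦ Hom(y, a)^∨` of `K`-valued characters. -/
def charPresheaf (y : C) : Cᵒᵖ ⥤ AddCommGrpCat where
  obj a := AddCommGrpCat.of (AddChar (y ⟶ a.unop) K)
  map i := AddCommGrpCat.ofHom (charPullback (Preadditive.rightComp y i.unop))
  map_id a := congrArg (fun φ => AddCommGrpCat.ofHom (charPullback φ)) <|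
    show Preadditive.rightComp y (𝟙 a.unop) = AddMonoidHom.id _ by ext; simp [Preadditive.rightComp]
  map_comp i j := congrArg (fun φ => AddCommGrpCat.ofHom (charPullback φ)) <|
    show Preadditive.rightComp y (j.unop ≫ i.unop) =
      (Preadditive.rightComp y i.unop).comp (Preadditive.rightComp y j.unop) by
      ext; simp [Preadditive.rightComp]

instance (y : C) : (charPresheaf K y).Additive where
  map_add {_ _ i j} := congrArg AddCommGrpCat.ofHom <|
    (congrArg charPullback <|
      show Preadditive.rightComp y (i.unop + j.unop) =
        Preadditive.rightComp y i.unop + Preadditive.rightComp y j.unop by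
      ext; simp [Preadditive.rightComp]).trans
    (charPullback_add _ _)

/-- The morphism of presheaves of characters induced by precomposition with `p`. -/
def charPresheafMap {y Y : C} (p : Y ⟶ y) : charPresheaf K Y ⟶ charPresheaf K y where
  app a := AddCommGrpCat.ofHom (charPullback (Preadditive.leftComp a.unop p))
  naturality a b i := congrArg (fun φ => AddCommGrpCat.ofHom (charPullback φ)) <|
    show (Preadditive.rightComp Y i.unop).comp (Preadditive.leftComp b.unop p) =
      (Preadditive.leftComp a.unop p).comp (Preadditive.rightComp y i.unop) by
      ext; simp [Preadditive.rightComp, Preadditive.leftComp]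

end CharPresheaf

end Depth

section DeltaBar

variable {k : Type w} [Field k] {C : Type u} [Category.{v} C]

lemma hom_map_hom_map (F : C ⥤ ModuleCat.{w} k) {x y z : C} (f : x ⟶ y) (g : y ⟶ z) (m : F.obj x) :
    (F.map g).hom ((F.map f).hom m) = (F.map (f ≫ g)).hom m := by
  rw [F.map_comp, ModuleCat.comp_apply]

variable [Preadditive C] [HasBinaryBiproducts C] (a : C) (F : C ⥤ ModuleCat.{w} k)

/-- The canonical projection `F (a ⊕ b) → δ̄_a(F)(b)`. -/
noncomputable def deltaBarProj (b : C) : F.obj (a ⊞ b) →ₗ[k] ((deltaBar k a).obj F).obj b :=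
  (((tauToTauBar k a).app F ≫ cokernel.π ((idToTauBar k a).app F)).app b).hom

lemma deltaBarProj_surjective (b : C) : Function.Surjective (deltaBarProj a F b) := by
  have hπ : Function.Surjective ((cokernel.π ((idToTauBar k a).app F)).app b).hom := by
    rw [← ModuleCat.epi_iff_surjective]
    infer_instance
  exact hπ.comp (Representation.Coinvariants.mk_surjective (shearRep F a b))

lemma deltaBarProj_naturality {b b' : C} (f : b ⟶ b') (z : F.obj (a ⊞ b)) :
    (((deltaBar k a).obj F).map f).hom (deltaBarProj a F b z) =
      deltaBarProj a F b' ((F.map (biprod.map (𝟙 a) f)).hom z) :=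
  congrArg (fun g => g.hom z)
    (((tauToTauBar k a).app F ≫ cokernel.π ((idToTauBar k a).app F)).naturality f).symm

lemma deltaBarProj_shear {b : C} (u : a ⟶ b) (z : F.obj (a ⊞ b)) :
    deltaBarProj a F b ((F.map (Biprod.unipotentUpper u).hom).hom z) = deltaBarProj a F b z :=
  congrArg ((cokernel.π ((idToTauBar k a).app F)).app b).hom
    (Representation.Coinvariants.mk_self_apply (shearRep F a b) (Multiplicative.ofAdd u) z)

lemma deltaBarProj_inr {b : C} (z : F.obj b) :
    deltaBarProj a F b ((F.map biprod.inr).hom z) = 0 := by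
  have hπ : ((idToTauBar k a).app F ≫ cokernel.π ((idToTauBar k a).app F)).app b = 0 := by
    rw [cokernel.condition, NatTrans.app_zero]
  exact congrArg (fun g => g.hom z) hπ

lemma exists_deltaBarProj_comp (b : C) {V : Type w} [AddCommGroup V] [Module k V]
    (ℓ : F.obj (a ⊞ b) →ₗ[k] V)
    (hshear : ∀ (u : a ⟶ b) z, ℓ ((F.map (Biprod.unipotentUpper u).hom).hom z) = ℓ z)
    (hinr : ∀ z, ℓ ((F.map biprod.inr).hom z) = 0) :
    ∃ μ : ((deltaBar k a).obj F).obj b →ₗ[k] V, ∀ z, μ (deltaBarProj a F b z) = ℓ z := by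
  let ℓ' : ((tauBar k a).obj F).obj b ⟶ ModuleCat.of k V := ModuleCat.ofHom <|
    Representation.Coinvariants.lift _ ℓ fun u => LinearMap.ext fun z => hshear u.toAdd z
  let isColimit := CokernelCofork.mapIsColimit _ (cokernelIsCokernel ((idToTauBar k a).app F))
    ((evaluation C (ModuleCat.{w} k)).obj b)
  obtain ⟨μ, hμ⟩ := CokernelCofork.IsColimit.desc' isColimit ℓ'
    (ModuleCat.hom_ext (LinearMap.ext hinr))
  exact ⟨μ.hom, fun z =>
    congrArg (fun g => g.hom (Representation.Coinvariants.mk (shearRep F a b) z)) hμ⟩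

lemma deltaBar_map_epi {F G : C ⥤ ModuleCat.{w} k} (α : F ⟶ G) [Epi α] :
    Epi ((deltaBar k a).map α) := by
  have hπ : cokernel.π ((idToTauBar k a).app F) ≫ (deltaBar k a).map α =
      (tauBar k a).map α ≫ cokernel.π ((idToTauBar k a).app G) := cokernel.π_desc _ _ _
  rw [NatTrans.epi_iff_epi_app]
  intro b
  rw [ModuleCat.epi_iff_surjective]
  intro m
  obtain ⟨z, rfl⟩ := deltaBarProj_surjective a G b m
  obtain ⟨z, rfl⟩ := (ModuleCat.epi_iff_surjective (α.app (a ⊞ b))).1 inferInstance z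
  exact ⟨deltaBarProj a F b z,
    congrArg (fun g => (g.app b).hom (Representation.Coinvariants.mk (shearRep F a b) z)) hπ⟩

/-- The canonical isomorphism `τ_{x ⊕ z} ≅ τ_z τ_x`. -/
noncomputable def tauTauIso (x z : C) (F : C ⥤ ModuleCat.{w} k) :
    (tau k (x ⊞ z)).obj F ≅ (tau k z).obj ((tau k x).obj F) :=
  Functor.isoWhiskerRight
    (NatIso.ofComponents (fun b => biprod.associator x z b) fun f => by
      dsimp only [addLeft, Functor.comp_obj, Functor.comp_map]
      ext <;> simp :
      addLeft (x ⊞ z) ≅ addLeft z ⋙ addLeft x) F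

/-- The exchange of the first two summands of `z ⊕ (a ⊕ b)`. -/
@[simps]
noncomputable def biprodLeftComm (z a b : C) : z ⊞ (a ⊞ b) ≅ a ⊞ (z ⊞ b) where
  hom := biprod.lift (biprod.snd ≫ biprod.fst) (biprod.map (𝟙 z) biprod.snd)
  inv := biprod.lift (biprod.snd ≫ biprod.fst) (biprod.map (𝟙 a) biprod.snd)
  hom_inv_id := by ext <;> simp
  inv_hom_id := by ext <;> simp

/-- The composite `F (z ⊕ (a ⊕ b)) ≅ F (a ⊕ (z ⊕ b)) → δ̄_a(F)(z ⊕ b)`, which induces the morphism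
`δ̄_a τ_z F ⟶ τ_z δ̄_a F`. -/
noncomputable def swapDeltaBarProj (z b : C) :
    F.obj (z ⊞ (a ⊞ b)) →ₗ[k] ((deltaBar k a).obj F).obj (z ⊞ b) :=
  deltaBarProj a F (z ⊞ b) ∘ₗ (F.map (biprodLeftComm z a b).hom).hom

lemma swapDeltaBarProj_surjective (z b : C) : Function.Surjective (swapDeltaBarProj a F z b) :=
  (deltaBarProj_surjective a F (z ⊞ b)).comp
    (F.mapIso (biprodLeftComm z a b)).toLinearEquiv.surjective

lemma swapDeltaBarProj_map {z b c : C} (f : c ⟶ z ⊞ (a ⊞ b)) (t : F.obj c) :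
    swapDeltaBarProj a F z b ((F.map f).hom t) =
      deltaBarProj a F (z ⊞ b) ((F.map (f ≫ (biprodLeftComm z a b).hom)).hom t) :=
  congrArg (deltaBarProj a F (z ⊞ b)) (hom_map_hom_map F f _ t)

lemma swapDeltaBarProj_naturality {z b b' : C} (g : b ⟶ b') (t : F.obj (z ⊞ (a ⊞ b))) :
    swapDeltaBarProj a F z b' ((F.map (biprod.map (𝟙 z) (biprod.map (𝟙 a) g))).hom t) =
      (((deltaBar k a).obj F).map (biprod.map (𝟙 z) g)).hom (swapDeltaBarProj a F z b t) := by
  have hcomm : biprod.map (𝟙 z) (biprod.map (𝟙 a) g) ≫ (biprodLeftComm z a b').hom =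
      (biprodLeftComm z a b).hom ≫ biprod.map (𝟙 a) (biprod.map (𝟙 z) g) := by
    ext <;> simp
  rw [swapDeltaBarProj_map, hcomm, ← hom_map_hom_map, ← deltaBarProj_naturality]
  rfl

lemma exists_comp_eq_swapDeltaBarProj (z b : C) :
    ∃ μ : ((deltaBar k a).obj ((tau k z).obj F)).obj b →ₗ[k] ((deltaBar k a).obj F).obj (z ⊞ b),
      ∀ t, μ (deltaBarProj a ((tau k z).obj F) b t) = swapDeltaBarProj a F z b t := by
  refine exists_deltaBarProj_comp a ((tau k z).obj F) b (swapDeltaBarProj a F z b)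
    (fun u t => ?_) fun t => ?_
  · have hcomm : biprod.map (𝟙 z) (Biprod.unipotentUpper u).hom ≫ (biprodLeftComm z a b).hom =
        (biprodLeftComm z a b).hom ≫ (Biprod.unipotentUpper (u ≫ biprod.inr)).hom := by
      ext <;> simp [Biprod.ofComponents]
    refine (swapDeltaBarProj_map a F (biprod.map (𝟙 z) (Biprod.unipotentUpper u).hom) t).trans ?_
    rw [hcomm]
    refine Eq.trans ?_ (deltaBarProj_shear a F (u ≫ biprod.inr) _)
    exact congrArg (deltaBarProj a F (z ⊞ b)) (hom_map_hom_map F _ _ t).symm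
  · have hcomm : biprod.map (𝟙 z) biprod.inr ≫ (biprodLeftComm z a b).hom = biprod.inr := by
      ext <;> simp
    refine (swapDeltaBarProj_map a F (biprod.map (𝟙 z) biprod.inr) t).trans ?_
    rw [hcomm]
    exact deltaBarProj_inr a F t

lemma exists_epi_deltaBar_tau (z : C) :
    ∃ α : (deltaBar k a).obj ((tau k z).obj F) ⟶ (tau k z).obj ((deltaBar k a).obj F), Epi α := by
  choose μ hμ using exists_comp_eq_swapDeltaBarProj a F z
  refine ⟨{ app := fun b => ModuleCat.ofHom (μ b), naturality := fun b b' g => ?_ }, ?_⟩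
  · apply ModuleCat.hom_ext
    ext m
    obtain ⟨t, rfl⟩ := deltaBarProj_surjective a ((tau k z).obj F) b m
    change μ b' ((((deltaBar k a).obj ((tau k z).obj F)).map g).hom _) =
      (((deltaBar k a).obj F).map (biprod.map (𝟙 z) g)).hom (μ b _)
    rw [deltaBarProj_naturality, hμ, hμ]
    exact swapDeltaBarProj_naturality a F g t
  · rw [NatTrans.epi_iff_epi_app]
    intro b
    rw [ModuleCat.epi_iff_surjective]
    intro m
    obtain ⟨t, rfl⟩ := swapDeltaBarProj_surjective a F z b m
    exact ⟨deltaBarProj a ((tau k z).obj F) b t, hμ b t⟩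

lemma exists_epi_deltaBarIter_tau (l : List C) (z : C) :
    ∃ α : (deltaBarIter k l).obj ((tau k z).obj F) ⟶ (tau k z).obj ((deltaBarIter k l).obj F),
      Epi α := by
  induction l with
  | nil => exact ⟨𝟙 ((tau k z).obj F), instEpiId _⟩
  | cons a l ih =>
    obtain ⟨α, _⟩ := ih
    obtain ⟨β, _⟩ := exists_epi_deltaBar_tau a ((deltaBarIter k l).obj F) z
    have := deltaBar_map_epi a α
    exact ⟨(deltaBar k a).map α ≫ β, epi_comp ((deltaBar k a).map α) β⟩

lemma exists_epi_tau (z : C) : ∃ α : (tau k z).obj F ⟶ F, Epi α := by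
  let α : (tau k z).obj F ⟶ F := Functor.whiskerRight
    ({ app := fun _ => biprod.snd
       naturality := fun _ _ f => biprod.map_snd (𝟙 z) f } : addLeft z ⟶ 𝟭 C) F
  have hα : (idToTau k z).app F ≫ α = 𝟙 F := by
    ext b : 2
    change F.map biprod.inr ≫ F.map biprod.snd = 𝟙 _
    rw [← F.map_comp, biprod.inr_snd, F.map_id]
  exact ⟨α, SplitEpi.epi ⟨_, hα⟩⟩

end DeltaBar

section Characters

variable {C : Type u} [Category.{v} C] [Preadditive C] {K : Type*} [Field K]

/-- The restrictions to `a` of a section `χ` of the presheaf of characters on `P`, as a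
homomorphism in the morphism along which one restricts. -/
def restrictHom {y P : C} (χ : AddChar (y ⟶ P) K) (a : C) : (a ⟶ P) →+ AddChar (y ⟶ a) K :=
  AddMonoidHom.mk' (fun u => χ.compAddMonoidHom (Preadditive.rightComp y u)) fun u u' => by
    ext v
    simp [Preadditive.rightComp, AddChar.map_add_eq_mul]

lemma restrictHom_apply_apply {y P a : C} (χ : AddChar (y ⟶ P) K) (u : a ⟶ P) (v : y ⟶ a) :
    restrictHom χ a u v = χ (v ≫ u) :=
  rfl

lemma exists_apply_comp_ne_one [IsAlgClosed K] {y P a b : C} [Fintype (y ⟶ a)]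
    (hK : (Fintype.card (y ⟶ a) : K) ≠ 0) {χ : AddChar (y ⟶ P) K} {i : b ⟶ P} {j : a ⟶ P}
    (hj : ∀ u : a ⟶ b, restrictHom χ a j ≠ restrictHom (restrictHom χ b i) a u) :
    ∃ t : y ⟶ a, (∀ u : a ⟶ b, χ (t ≫ u ≫ i) = 1) ∧ χ (t ≫ j) ≠ 1 := by
  obtain ⟨t, hti, htj⟩ := exists_apply_ne_one_of_notMem hK
    (H := (restrictHom (restrictHom χ b i) a).range) (θ := restrictHom χ a j)
    (by rintro ⟨u, hu⟩; exact hj u hu.symm)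
  refine ⟨t, fun u => ?_, htj⟩
  rw [← Category.assoc]
  exact hti _ ⟨u, rfl⟩

section Biproduct

variable [HasBinaryBiproducts C]

/-- The character of `Hom(Y, a ⊕ P) ≃ Hom(Y, a) × Hom(Y, P)` with components `θ` and `ρ`. -/
noncomputable def charBiprod {Y a P : C} (θ : AddChar (Y ⟶ a) K) (ρ : AddChar (Y ⟶ P) K) :
    AddChar (Y ⟶ a ⊞ P) K :=
  restrictHom ρ (a ⊞ P) biprod.snd + restrictHom θ (a ⊞ P) biprod.fst

lemma charBiprod_apply {Y a P : C} (θ : AddChar (Y ⟶ a) K) (ρ : AddChar (Y ⟶ P) K)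
    (w : Y ⟶ a ⊞ P) : charBiprod θ ρ w = ρ (w ≫ biprod.snd) * θ (w ≫ biprod.fst) :=
  rfl

lemma restrictHom_inl_charBiprod {Y a P : C} (θ : AddChar (Y ⟶ a) K) (ρ : AddChar (Y ⟶ P) K) :
    restrictHom (charBiprod θ ρ) a biprod.inl = θ := by
  ext v
  simp [restrictHom_apply_apply, charBiprod_apply]

lemma restrictHom_inr_charBiprod {Y a P : C} (θ : AddChar (Y ⟶ a) K) (ρ : AddChar (Y ⟶ P) K) :
    restrictHom (charBiprod θ ρ) P biprod.inr = ρ := by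
  ext v
  simp [restrictHom_apply_apply, charBiprod_apply]

lemma charBiprod_restrictHom {Y a P : C} (ψ : AddChar (Y ⟶ a ⊞ P) K) :
    charBiprod (restrictHom ψ a biprod.inl) (restrictHom ψ P biprod.inr) = ψ := by
  ext w
  rw [charBiprod_apply, restrictHom_apply_apply, restrictHom_apply_apply,
    ← AddChar.map_add_eq_mul, add_comm, Category.assoc, Category.assoc, ← Preadditive.comp_add,
    biprod.total, Category.comp_id]

end Biproduct

variable [∀ x y : C, Fintype (x ⟶ y)] [HasBinaryBiproducts C]

lemma fourierSum_comp_biprod_map_eq_zero [IsAlgClosed K]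
    (hK : ∀ x y : C, (Fintype.card (x ⟶ y) : K) ≠ 0) {a y P : C} {r : ℕ}
    {f : (a ⊞ y ⟶ a ⊞ P) → K}
    (hf : ∀ ψ : AddChar (a ⊞ y ⟶ a ⊞ P) K,
      HasDepth (charPresheaf K (a ⊞ y)) r (restrictHom ψ P biprod.inr) → fourierSum ψ f = 0)
    {χ : AddChar (y ⟶ P) K} (hχ : HasDepth (charPresheaf K y) r χ) :
    fourierSum χ (fun v => f (biprod.map (𝟙 a) v)) = 0 := by
  let φ : (y ⟶ P) →+ (a ⊞ y ⟶ a ⊞ P) :=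
    (Preadditive.rightComp (a ⊞ y) biprod.inr).comp (Preadditive.leftComp P biprod.snd)
  have hφ (v : y ⟶ P) : biprod.map (𝟙 a) v = φ v + biprod.fst ≫ biprod.inl := by
    rw [biprod.map_eq, Category.id_comp, add_comm, ← Category.assoc]
    rfl
  simp only [hφ]
  refine fourierSum_comp_add_eq_zero (hK (a ⊞ y) (a ⊞ P)) φ _ ?_
  rintro ψ rfl
  exact hf ψ (HasDepth.of_app (charPresheafMap biprod.snd) hχ)

lemma fourierSum_charBiprod_restrictHom {Y a P : C} {f : (Y ⟶ a ⊞ P) → K} (u : a ⟶ P)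
    (hshear : ∀ w, f (w ≫ (Biprod.unipotentUpper u).hom) = f w) (ρ : AddChar (Y ⟶ P) K) :
    fourierSum (charBiprod (restrictHom ρ a u) ρ) f =
      fourierSum (restrictHom ρ (a ⊞ P) biprod.snd) f := by
  refine Fintype.sum_equiv (Biprod.unipotentUpper u).homToEquiv _ _ fun w => ?_
  have hsnd : (Biprod.unipotentUpper u).hom ≫ biprod.snd =
      (biprod.snd + biprod.fst ≫ u : a ⊞ P ⟶ P) := by
    ext <;> simp [Biprod.ofComponents]
  rw [Iso.homToEquiv_apply, hshear, charBiprod_apply, restrictHom_apply_apply,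
    restrictHom_apply_apply, ← AddChar.map_add_eq_mul, Category.assoc, Category.assoc, hsnd,
    Preadditive.comp_add]

lemma fourierSum_eq_zero_of_shear_invariant [IsAlgClosed K]
    (hK : ∀ x y : C, (Fintype.card (x ⟶ y) : K) ≠ 0) {Y a P : C} {r : ℕ}
    {f : (Y ⟶ a ⊞ P) → K} (hshear : ∀ (u : a ⟶ P) w, f (w ≫ (Biprod.unipotentUpper u).hom) = f w)
    (hfst : ∀ w, w ≫ biprod.fst = 0 → f w = 0)
    (hf : ∀ ψ : AddChar (Y ⟶ a ⊞ P) K, HasDepth (charPresheaf K Y) (r + 1) ψ → fourierSum ψ f = 0)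
    {ψ : AddChar (Y ⟶ a ⊞ P) K}
    (hψ : HasDepth (charPresheaf K Y) r (restrictHom ψ P biprod.inr)) :
    fourierSum ψ f = 0 := by
  rw [← charBiprod_restrictHom ψ]
  refine fourierSum_add_comp_eq_zero_of_addSubgroup (hK Y a)
    (Preadditive.rightComp Y biprod.fst) hfst _
    (restrictHom (restrictHom ψ P biprod.inr) a).range ?_ (fun θ hθ => ?_) _
  · rintro _ ⟨u, rfl⟩
    exact fourierSum_charBiprod_restrictHom u (hshear u) _
  · refine hf (charBiprod θ (restrictHom ψ P biprod.inr))
      ⟨a, P, biprod.inr, biprod.inl, ?_, fun u hu => hθ ⟨u, ?_⟩⟩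
    · exact (restrictHom_inr_charBiprod θ _).symm ▸ hψ
    · change restrictHom _ a biprod.inl = restrictHom (restrictHom _ P biprod.inr) a u at hu
      rw [restrictHom_inl_charBiprod, restrictHom_inr_charBiprod] at hu
      exact hu.symm

end Characters

section FourierVanishes

open scoped TensorProduct

variable {k : Type w} [Field k] {C : Type u} [Category.{v} C] [Preadditive C]
  [∀ x y : C, Fintype (x ⟶ y)]

/-- The Fourier coefficients of all the functions `v ↦ ℓ (F(v) z)` on the groups `Hom(y, P)`
vanish at the characters of depth at least `r`. -/
def FourierVanishes (K : Type*) [Field K] [Algebra k K] (r : ℕ) (F : C ⥤ ModuleCat.{w} k) : Prop :=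
  ∀ ⦃y P : C⦄ (χ : AddChar (y ⟶ P) K), HasDepth (charPresheaf K y) r χ →
    ∀ (ℓ : F.obj P →ₗ[k] K) (z : F.obj y), fourierSum χ (fun v => ℓ ((F.map v).hom z)) = 0

variable {K : Type*} [Field K] [Algebra k K] {r : ℕ} {F G : C ⥤ ModuleCat.{w} k}

lemma FourierVanishes.of_isZero (hF : IsZero F) : FourierVanishes K r F := by
  intro y P χ _ ℓ z
  have : Subsingleton (F.obj P) := ModuleCat.subsingleton_of_isZero (hF.obj P)
  refine Finset.sum_eq_zero fun v _ => ?_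
  simp only [Subsingleton.elim ((F.map v).hom z) 0, map_zero, mul_zero]

lemma FourierVanishes.of_epi (hF : FourierVanishes K r F) (α : F ⟶ G) [Epi α] :
    FourierVanishes K r G := by
  intro y P χ hχ ℓ z
  obtain ⟨z, rfl⟩ := (ModuleCat.epi_iff_surjective (α.app y)).1 inferInstance z
  rw [← hF χ hχ (ℓ ∘ₗ (α.app P).hom) z]
  congr 1
  ext v
  exact congrArg ℓ (NatTrans.naturality_apply α v z).symm

variable [IsAlgClosed K] (hK : ∀ x y : C, (Fintype.card (x ⟶ y) : K) ≠ 0)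
include hK

lemma FourierVanishes.isZero (hF : FourierVanishes K 0 F) : IsZero F := by
  refine Functor.isZero _ fun P => ?_
  rw [ModuleCat.isZero_iff_subsingleton]
  refine subsingleton_of_forall_eq 0 fun z =>
    (Module.forall_dual_apply_eq_zero_iff k z).1 fun ℓ => ?_
  have hℓ := eq_zero_of_fourierSum_eq_zero (hK P P)
    fun χ => hF χ trivial (Algebra.linearMap k K ∘ₗ ℓ) z
  simpa using congrFun hℓ (𝟙 P)

variable [HasBinaryBiproducts C]

lemma FourierVanishes.tensor {n m : ℕ} (hF : FourierVanishes K (n + 1) F)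
    (hG : FourierVanishes K (m + 1) G) : FourierVanishes K (n + m + 1) (F ⊗ G) := by
  intro y P χ hχ (ℓ : F.obj P ⊗[k] G.obj P →ₗ[k] K) (z : F.obj y ⊗[k] G.obj y)
  change fourierSum χ (fun v => ℓ (TensorProduct.map (F.map v).hom (G.map v).hom z)) = 0
  induction z using TensorProduct.induction_on with
  | zero => simp [fourierSum]
  | add z z' hz hz' =>
    simp only [fourierSum, map_add, mul_add, Finset.sum_add_distrib] at hz hz' ⊢
    rw [hz, hz', add_zero]
  | tmul z t =>
    refine fourierSum_diag_eq_zero (hK y P)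
      (h := fun v v' => ℓ ((F.map v).hom z ⊗ₜ (G.map v').hom t)) fun χ₁ χ₂ hadd => ?_
    subst hadd
    obtain ⟨p, q, hpq, hp, c, e, -, hq⟩ := exists_hasDepth_of_hasDepth_add hχ
    obtain hn | hm : n + 1 ≤ p ∨ m + 1 ≤ q := by omega
    · exact .inl fun v' => hF χ₁ (hp.mono hn)
        (ℓ ∘ₗ (TensorProduct.mk k (F.obj P) (G.obj P)).flip ((G.map v').hom t)) z
    · exact .inr fun v => hG χ₂ ((hq.of_map e).mono hm)
        (ℓ ∘ₗ TensorProduct.mk k (F.obj P) (G.obj P) ((F.map v).hom z)) t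

lemma FourierVanishes.tau_obj (hF : FourierVanishes K r F) (x : C) :
    FourierVanishes K r ((tau k x).obj F) := by
  intro y P χ hχ (ℓ : F.obj (x ⊞ P) →ₗ[k] K) (z : F.obj (x ⊞ y))
  exact fourierSum_comp_biprod_map_eq_zero hK (f := fun w => ℓ ((F.map w).hom z))
    (fun ψ hψ => hF ψ (HasDepth.of_map biprod.inr hψ) ℓ z) hχ

lemma FourierVanishes.deltaBar_obj (hF : FourierVanishes K (r + 1) F) (a : C) :
    FourierVanishes K r ((deltaBar k a).obj F) := by
  intro y P χ hχ μ m
  obtain ⟨z, rfl⟩ := deltaBarProj_surjective a F y m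
  let f (w : a ⊞ y ⟶ a ⊞ P) : K := μ (deltaBarProj a F P ((F.map w).hom z))
  have hshear (u : a ⟶ P) (w) : f (w ≫ (Biprod.unipotentUpper u).hom) = f w := by
    simp only [f]
    rw [← hom_map_hom_map, deltaBarProj_shear]
  have hfst (w : a ⊞ y ⟶ a ⊞ P) (hw : w ≫ biprod.fst = 0) : f w = 0 := by
    have hw_eq : w = (w ≫ biprod.snd) ≫ biprod.inr := by
      ext <;> simp [hw]
    simp only [f]
    rw [hw_eq, ← hom_map_hom_map, deltaBarProj_inr, map_zero]
  simp only [deltaBarProj_naturality]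
  exact fourierSum_comp_biprod_map_eq_zero hK (fun ψ hψ =>
    fourierSum_eq_zero_of_shear_invariant hK hshear hfst
      (fun ψ hψ => hF ψ hψ (μ ∘ₗ deltaBarProj a F P) z) hψ) hχ

lemma FourierVanishes.deltaBarIter_obj (l : List C) (hF : FourierVanishes K (r + l.length) F) :
    FourierVanishes K r ((deltaBarIter k l).obj F) := by
  induction l generalizing r with
  | nil => exact hF
  | cons a l ih =>
    rw [List.length_cons, ← add_assoc, add_right_comm] at hF
    exact (ih hF).deltaBar_obj hK a

end FourierVanishes

section FromDifferences

variable {k : Type w} [Field k] {C : Type u} [Category.{v} C] [Preadditive C]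
  [HasBinaryBiproducts C] [∀ x y : C, Fintype (x ⟶ y)] {K : Type w} [Field K] [Algebra k K]
  {F : C ⥤ ModuleCat.{w} k} {y a b P : C}

/-- The linear form `m ↦ ∑ v, χ v * ℓ (F (v, g, i) m)` on `F (y ⊕ (a ⊕ b))`. -/
noncomputable def descSum (χ : AddChar (y ⟶ P) K) (i : b ⟶ P) (ℓ : F.obj P →ₗ[k] K)
    (g : a ⟶ P) : F.obj (y ⊞ (a ⊞ b)) →ₗ[k] K :=
  ∑ v, χ v • ℓ ∘ₗ (F.map (biprod.desc v (biprod.desc g i))).hom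

lemma descSum_apply (χ : AddChar (y ⟶ P) K) (i : b ⟶ P) (ℓ : F.obj P →ₗ[k] K) (g : a ⟶ P) (m) :
    descSum χ i ℓ g m =
      fourierSum χ (fun v => ℓ ((F.map (biprod.desc v (biprod.desc g i))).hom m)) := by
  simp [descSum, fourierSum]

variable (χ : AddChar (y ⟶ P) K) (i : b ⟶ P) (j : a ⟶ P) (ℓ : F.obj P →ₗ[k] K)

lemma descSum_map_shear (g : a ⟶ P) (u : a ⟶ b) (m : F.obj (y ⊞ (a ⊞ b))) :
    descSum χ i ℓ g ((F.map (biprod.map (𝟙 y) (Biprod.unipotentUpper u).hom)).hom m) =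
      descSum χ i ℓ (g + u ≫ i) m := by
  have hdesc (v : y ⟶ P) : biprod.map (𝟙 y) (Biprod.unipotentUpper u).hom ≫
      biprod.desc v (biprod.desc g i) = biprod.desc v (biprod.desc (g + u ≫ i) i) := by
    ext <;> simp [Biprod.ofComponents]
  simp only [descSum_apply, hom_map_hom_map, hdesc]

lemma descSum_map_inr (g : a ⟶ P) (m : F.obj (y ⊞ b)) :
    descSum χ i ℓ g ((F.map (biprod.map (𝟙 y) biprod.inr)).hom m) =
      fourierSum χ (fun v => ℓ ((F.map (biprod.desc v i)).hom m)) := by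
  have hdesc (v : y ⟶ P) : biprod.map (𝟙 y) biprod.inr ≫ biprod.desc v (biprod.desc g i) =
      biprod.desc v i := by
    ext <;> simp
  simp only [descSum_apply, hom_map_hom_map, hdesc]

lemma descSum_map_lift (g : a ⟶ P) (t : y ⟶ a) (s : y ⟶ b) (z : F.obj y) :
    descSum χ i ℓ g ((F.map (biprod.lift (𝟙 y) (biprod.lift t s))).hom z) =
      χ (-(t ≫ g + s ≫ i)) * fourierSum χ (fun v => ℓ ((F.map v).hom z)) := by
  have hlift (v : y ⟶ P) : biprod.lift (𝟙 y) (biprod.lift t s) ≫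
      biprod.desc v (biprod.desc g i) = v + (t ≫ g + s ≫ i) := by
    simp
  simp only [descSum_apply, hom_map_hom_map, hlift]
  exact fourierSum_add_right χ (fun v => ℓ ((F.map v).hom z)) _

lemma exists_deltaBar_tau_comp_eq_sum_descSum :
    ∃ μ : ((deltaBar k a).obj ((tau k y).obj F)).obj b →ₗ[k] K,
      ∀ m : F.obj (y ⊞ (a ⊞ b)), μ (deltaBarProj a ((tau k y).obj F) b m) =
        ∑ u : a ⟶ b, (descSum χ i ℓ (j + u ≫ i) m - descSum χ i ℓ (u ≫ i) m) := by
  let lam : F.obj (y ⊞ (a ⊞ b)) →ₗ[k] K :=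
    ∑ u : a ⟶ b, (descSum χ i ℓ (j + u ≫ i) - descSum χ i ℓ (u ≫ i))
  have hlam (m) : lam m =
      ∑ u : a ⟶ b, (descSum χ i ℓ (j + u ≫ i) m - descSum χ i ℓ (u ≫ i) m) := by
    simp [lam]
  have hshear (u : a ⟶ b) (m : F.obj (y ⊞ (a ⊞ b))) :
      lam ((F.map (biprod.map (𝟙 y) (Biprod.unipotentUpper u).hom)).hom m) = lam m := by
    simp only [hlam, descSum_map_shear]
    refine Fintype.sum_equiv (Equiv.addRight u) _ _ fun u' => ?_
    simp only [Equiv.coe_addRight, Preadditive.add_comp, add_assoc]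
  have hinr (m : F.obj (y ⊞ b)) : lam ((F.map (biprod.map (𝟙 y) biprod.inr)).hom m) = 0 := by
    simp only [hlam, descSum_map_inr, sub_self, Finset.sum_const_zero]
  obtain ⟨μ, hμ⟩ := exists_deltaBarProj_comp a ((tau k y).obj F) b lam hshear hinr
  exact ⟨μ, fun m => (hμ m).trans (hlam m)⟩

variable {χ i j} in
lemma mul_sum_descSum_map_lift {t : y ⟶ a} (ht : ∀ u : a ⟶ b, χ (t ≫ u ≫ i) = 1) (s : y ⟶ b)
    (z : F.obj y) {m : F.obj (y ⊞ (a ⊞ b))}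
    (hm : m = (F.map (biprod.lift (𝟙 y) (biprod.lift t s))).hom z) :
    χ (s ≫ i) * ∑ u : a ⟶ b, (descSum χ i ℓ (j + u ≫ i) m - descSum χ i ℓ (u ≫ i) m) =
      Fintype.card (a ⟶ b) *
        ((χ (-(t ≫ j)) - 1) * fourierSum χ (fun v => ℓ ((F.map v).hom z))) := by
  have hs : χ (s ≫ i) * (χ (s ≫ i))⁻¹ = 1 := by
    rw [← AddChar.map_neg_eq_inv, ← AddChar.map_add_eq_mul, add_neg_cancel,
      AddChar.map_zero_eq_one]
  rw [Finset.mul_sum, ← nsmul_eq_mul, ← Finset.card_univ, ← Finset.sum_const]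
  refine Finset.sum_congr rfl fun u _ => ?_
  simp only [hm, descSum_map_lift, Preadditive.comp_add, AddChar.map_neg_eq_inv,
    AddChar.map_add_eq_mul, ht, mul_one, one_mul, mul_inv]
  linear_combination ((χ (t ≫ j))⁻¹ - 1) * fourierSum χ (fun v => ℓ ((F.map v).hom z)) * hs

variable [IsAlgClosed K] (hK : ∀ x y : C, (Fintype.card (x ⟶ y) : K) ≠ 0)
include hK

lemma FourierVanishes.of_deltaBar_tau {r : ℕ}
    (hF : ∀ a x, FourierVanishes K r ((deltaBar k a).obj ((tau k x).obj F))) :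
    FourierVanishes K (r + 1) F := by
  rintro y P χ ⟨a, b, i, j, hi, hj⟩ ℓ z
  obtain ⟨t, hti, htj⟩ := exists_apply_comp_ne_one (i := i) (j := j) (hK y a) hj
  obtain ⟨μ, hμ⟩ := exists_deltaBar_tau_comp_eq_sum_descSum (F := F) χ i j ℓ
  let z' : ((tau k y).obj F).obj (a ⊞ y) :=
    (F.map (biprod.lift (𝟙 y) (biprod.lift t (𝟙 y)))).hom z
  have hz' (s : y ⟶ b) : (((tau k y).obj F).map (biprod.map (𝟙 a) s)).hom z' =
      (F.map (biprod.lift (𝟙 y) (biprod.lift t s))).hom z := by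
    have hlift : biprod.lift (𝟙 y) (biprod.lift t (𝟙 y)) ≫
        biprod.map (𝟙 y) (biprod.map (𝟙 a) s) = biprod.lift (𝟙 y) (biprod.lift t s) := by
      ext <;> simp
    rw [← hlift]
    exact hom_map_hom_map F _ _ z
  have hterm (s : y ⟶ b) :
      χ (s ≫ i) * μ ((((deltaBar k a).obj ((tau k y).obj F)).map s).hom
        (deltaBarProj a ((tau k y).obj F) y z')) =
      Fintype.card (a ⟶ b) *
        ((χ (-(t ≫ j)) - 1) * fourierSum χ (fun v => ℓ ((F.map v).hom z))) := by
    rw [deltaBarProj_naturality]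
    exact (congrArg (χ (s ≫ i) * ·) (hμ _)).trans (mul_sum_descSum_map_lift ℓ hti s z (hz' s))
  have hvanish := (Finset.sum_congr rfl fun s _ => hterm s).symm.trans
    (hF a y (restrictHom χ b i) hi μ (deltaBarProj a ((tau k y).obj F) y z'))
  rwa [Finset.sum_const, Finset.card_univ, nsmul_eq_mul, mul_eq_zero_iff_left (hK y b),
    mul_eq_zero_iff_left (hK a b), AddChar.map_neg_eq_inv,
    mul_eq_zero_iff_left (sub_ne_zero.2 (inv_ne_one.2 htj))] at hvanish

end FromDifferences

section Characterization

variable {k : Type w} [Field k] {C : Type u} [Category.{v} C] [Preadditive C]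
  [HasBinaryBiproducts C] [∀ x y : C, Fintype (x ⟶ y)] {K : Type w} [Field K] [Algebra k K]
  [IsAlgClosed K] (hK : ∀ x y : C, (Fintype.card (x ⟶ y) : K) ≠ 0)
  {F : C ⥤ ModuleCat.{w} k}
include hK

lemma FourierVanishes.of_deltaBarIter_tau {r s : ℕ}
    (hF : ∀ (l : List C) (x : C), l.length = s →
      FourierVanishes K r ((deltaBarIter k l).obj ((tau k x).obj F))) :
    FourierVanishes K (r + s) F := by
  induction s generalizing r with
  | zero =>
    intro y
    obtain ⟨α, _⟩ := exists_epi_tau F y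
    have hτF : FourierVanishes K r ((tau k y).obj F) := hF [] y rfl
    exact hτF.of_epi α (y := y)
  | succ s ih =>
    rw [← add_assoc, add_right_comm]
    refine ih fun l x hl => of_deltaBar_tau hK fun a z => ?_
    obtain ⟨α, _⟩ := exists_epi_deltaBarIter_tau ((tau k x).obj F) l z
    let β := (deltaBarIter k l).map (tauTauIso x z F).hom ≫ α
    have : Epi β := epi_comp _ _
    have := deltaBar_map_epi a β
    have hδτF : FourierVanishes K r
        ((deltaBar k a).obj ((deltaBarIter k l).obj ((tau k (x ⊞ z)).obj F))) :=
      hF (a :: l) (x ⊞ z) (congrArg (· + 1) hl)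
    exact hδτF.of_epi ((deltaBar k a).map β)

lemma isInF_iff_fourierVanishes (d : ℕ) : IsInF k C d F ↔ FourierVanishes K (d + 1) F := by
  refine ⟨fun hF => ?_, fun hF a x => ?_⟩
  · rw [← zero_add (d + 1)]
    refine .of_deltaBarIter_tau hK fun l x hl => .of_isZero ?_
    obtain ⟨a, rfl⟩ : ∃ a : Fin (d + 1) → C, List.ofFn a = l := by
      exact ⟨fun i => l.get (i.cast hl.symm), List.ext_getElem (by simp [hl])
        fun i h1 h2 => by rw [List.getElem_ofFn]; rfl⟩
    exact hF a x
  · have hτF := hF.tau_obj hK x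
    rw [← zero_add (d + 1), ← List.length_ofFn (f := a)] at hτF
    exact (hτF.deltaBarIter_obj hK (List.ofFn a)).isZero hK

end Characterization

end ParabolicFunctors

theorem mainTheorem12_general (k : Type w) [Field k] (C : Type u) [Category.{v} C] [Preadditive C]
    [HasBinaryBiproducts C] (hC : ParabolicFunctors.IsKTrivial k C) (n m : ℕ)
    (F G : C ⥤ ModuleCat.{w} k) (hF : ParabolicFunctors.IsInF k C n F)
    (hG : ParabolicFunctors.IsInF k C m G) : ParabolicFunctors.IsInF k C (n + m) (F ⊗ G) := by
  have (x y : C) : Finite (x ⟶ y) := hC.finite_hom x y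
  have (x y : C) : Fintype (x ⟶ y) := Fintype.ofFinite _
  have hK (x y : C) : (Fintype.card (x ⟶ y) : AlgebraicClosure k) ≠ 0 := by
    rw [← Nat.card_eq_fintype_card, ← map_natCast (algebraMap k (AlgebraicClosure k)), Ne,
      FaithfulSMul.algebraMap_eq_zero_iff]
    exact (hC.isUnit_card x y).ne_zero
  rw [ParabolicFunctors.isInF_iff_fourierVanishes hK] at hF hG ⊢
  exact hF.tensor hK hG

theorem mainTheorem12 (k : Type w) [Field k] (C : Type u) [Category.{v} C] [Preadditive C]
    [HasZeroObject C] [HasBinaryBiproducts C] [EssentiallySmall.{w} C]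
    (hC : ParabolicFunctors.IsKTrivial k C) (n m : ℕ) (F G : C ⥤ ModuleCat.{w} k)
    (hF : ParabolicFunctors.IsInF k C n F) (hG : ParabolicFunctors.IsInF k C m G) :
    ParabolicFunctors.IsInF k C (n + m) (F ⊗ G) :=
  mainTheorem12_general k C hC n m F G hF hG
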